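/- Let $\mathbb F$ be an algebraically closed field. Two pairs $(A,B)$, $(C,D)$ of $n\times n$ matrices over $\mathbb F$ are called similar if there is an invertible matrix $X$ over $\mathbb F$ with $X^{-1}AX=C$ and $X^{-1}BX=D$. A pair is called decomposable if it is similar to a pair of the form $$\left(\begin{bmatrix}A_1&0\\0&A_2\end{bmatrix},\begin{bmatrix}B_1&0\\0&B_2\end{bmatrix}\right),$$ where $A_1,B_1$ are square of the same size $p\ge 1$ and $A_2,B_2$ are square of the same size $q\ge 1$; otherwise it is indecomposable. **Theorem.** Every indecomposable pair of commuting nilpotent $4\times4$ matrices over $\mathbb F$ is similar to a unique pair in one of the following forms, where $\lambda,\mu,\nu\in\mathbb F$ (that is, both the form and the values of the parameters occurring in it are uniquely determined): $$(1.1)\quad\left(\begin{bmatrix}0&1&0&0\\0&0&1&0\\0&0&0&1\\0&0&0&0\end{bmatrix},\begin{bmatrix}0&\lambda&\mu&\nu\\0&0&\lambda&\mu\\0&0&0&\lambda\\0&0&0&0\end{bmatrix}\right)$$ $$(2.1)\quad\left(\begin{bmatrix}0&1&0&0\\0&0&1&0\\0&0&0&0\\0&0&0&0\end{bmatrix},\begin{bmatrix}0&\lambda&0&\mu\\0&0&\lambda&0\\0&0&0&0\\0&0&1&0\end{bmatrix}\right)$$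 $$(2.2)\quad\left(\begin{bmatrix}0&1&0&0\\0&0&1&0\\0&0&0&0\\0&0&0&0\end{bmatrix},\begin{bmatrix}0&\lambda&0&1\\0&0&\lambda&0\\0&0&0&0\\0&0&0&0\end{bmatrix}\right)$$ $$(3.1)\quad\left(\begin{bmatrix}0&1&0&0\\0&0&0&0\\0&0&0&1\\0&0&0&0\end{bmatrix},\begin{bmatrix}0&0&1&0\\0&0&0&1\\0&\lambda&0&\mu\\0&0&0&0\end{bmatrix}\right)$$ $$(3.2)\quad\left(\begin{bmatrix}0&1&0&0\\0&0&0&0\\0&0&0&1\\0&0&0&0\end{bmatrix},\begin{bmatrix}0&\lambda&0&1\\0&0&0&0\\0&0&0&\lambda\\0&0&0&0\end{bmatrix}\right)$$ $$(4.1)\quad\left(\begin{bmatrix}0&1&0&0\\0&0&0&0\\0&0&0&0\\0&0&0&0\end{bmatrix},\begin{bmatrix}0&0&\lambda&0\\0&0&0&0\\0&0&0&1\\0&1&0&0\end{bmatrix}\right)$$ $$(4.2)\quad\left(\begin{bmatrix}0&1&0&0\\0&0&0&0\\0&0&0&0\\0&0&0&0\end{bmatrix},\begin{bmatrix}0&0&1&0\\0&0&0&0\\0&0&0&1\\0&0&0&0\end{bmatrix}\right)$$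 $$(4.3)\quad\left(\begin{bmatrix}0&1&0&0\\0&0&0&0\\0&0&0&0\\0&0&0&0\end{bmatrix},\begin{bmatrix}0&0&1&0\\0&0&0&0\\0&0&0&0\\0&1&0&0\end{bmatrix}\right)$$ $$(5.1)\quad\left(\begin{bmatrix}0&0&0&0\\0&0&0&0\\0&0&0&0\\0&0&0&0\end{bmatrix},\begin{bmatrix}0&1&0&0\\0&0&1&0\\0&0&0&1\\0&0&0&0\end{bmatrix}\right)$$ Conversely, for all $\lambda,\mu,\nu\in\mathbb F$, each of the pairs above is an indecomposable pair of commuting nilpotent matrices. -/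

import Mathlib

namespace CommNilp

/-- Pairs of `n × n` matrices over `F`. -/
abbrev MatPair (n : ℕ) (F : Type*) : Type _ :=
  Matrix (Fin n) (Fin n) F × Matrix (Fin n) (Fin n) F

/-- Simultaneous similarity of pairs: `X⁻¹ A X = C` and `X⁻¹ B X = D` for one invertible `X`. -/
def Similar {n : ℕ} {F : Type*} [Field F] (P Q : MatPair n F) : Prop :=
  ∃ X : GL (Fin n) F,
    (X⁻¹).val * P.1 * X.val = Q.1 ∧ (X⁻¹).val * P.2 * X.val = Q.2

/-- The block diagonal `n × n` matrix with diagonal blocks `M` (upper left, of size `p`) and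
`N` (lower right, of size `q`), where `p + q = n`. -/
def blockDiag {n p q : ℕ} {F : Type*} [Field F] (h : p + q = n)
    (M : Matrix (Fin p) (Fin p) F) (N : Matrix (Fin q) (Fin q) F) :
    Matrix (Fin n) (Fin n) F :=
  Matrix.reindex (finSumFinEquiv.trans (finCongr h)) (finSumFinEquiv.trans (finCongr h))
    (Matrix.fromBlocks M 0 0 N)

/-- A pair is decomposable if it is similar to a pair of block diagonal matrices
with the same two block sizes, both of them positive. -/
def IsDecomposable {n : ℕ} {F : Type*} [Field F] (P : MatPair n F) : Prop :=
  ∃ (p q : ℕ) (h : p + q = n), 0 < p ∧ 0 < q ∧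
    ∃ (A₁ B₁ : Matrix (Fin p) (Fin p) F) (A₂ B₂ : Matrix (Fin q) (Fin q) F),
      Similar P (blockDiag h A₁ A₂, blockDiag h B₁ B₂)

/-- A pair of commuting nilpotent matrices. -/
def IsCommutingNilpotent {n : ℕ} {F : Type*} [Field F] (P : MatPair n F) : Prop :=
  IsNilpotent P.1 ∧ IsNilpotent P.2 ∧ P.1 * P.2 = P.2 * P.1

/-- Names for the canonical forms: one of the nine families together with a value for each of
the parameters of that family. -/
inductive CanonicalForm (F : Type*) : Type _
  | f11 (l m v : F)
  | f21 (l m : F)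
  | f22 (l : F)
  | f31 (l m : F)
  | f32 (l : F)
  | f41 (l : F)
  | f42
  | f43
  | f51

/-- The pair of `4 × 4` matrices that a canonical form names. -/
def CanonicalForm.toPair {F : Type*} [Field F] : CanonicalForm F → MatPair 4 F
  | .f11 l m v =>
    (!![0, 1, 0, 0;
        0, 0, 1, 0;
        0, 0, 0, 1;
        0, 0, 0, 0],
     !![0, l, m, v;
        0, 0, l, m;
        0, 0, 0, l;
        0, 0, 0, 0])
  | .f21 l m =>
    (!![0, 1, 0, 0;
        0, 0, 1, 0;
        0, 0, 0, 0;
        0, 0, 0, 0],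
     !![0, l, 0, m;
        0, 0, l, 0;
        0, 0, 0, 0;
        0, 0, 1, 0])
  | .f22 l =>
    (!![0, 1, 0, 0;
        0, 0, 1, 0;
        0, 0, 0, 0;
        0, 0, 0, 0],
     !![0, l, 0, 1;
        0, 0, l, 0;
        0, 0, 0, 0;
        0, 0, 0, 0])
  | .f31 l m =>
    (!![0, 1, 0, 0;
        0, 0, 0, 0;
        0, 0, 0, 1;
        0, 0, 0, 0],
     !![0, 0, 1, 0;
        0, 0, 0, 1;
        0, l, 0, m;
        0, 0, 0, 0])
  | .f32 l =>
    (!![0, 1, 0, 0;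
        0, 0, 0, 0;
        0, 0, 0, 1;
        0, 0, 0, 0],
     !![0, l, 0, 1;
        0, 0, 0, 0;
        0, 0, 0, l;
        0, 0, 0, 0])
  | .f41 l =>
    (!![0, 1, 0, 0;
        0, 0, 0, 0;
        0, 0, 0, 0;
        0, 0, 0, 0],
     !![0, 0, l, 0;
        0, 0, 0, 0;
        0, 0, 0, 1;
        0, 1, 0, 0])
  | .f42 =>
    (!![0, 1, 0, 0;
        0, 0, 0, 0;
        0, 0, 0, 0;
        0, 0, 0, 0],
     !![0, 0, 1, 0;
        0, 0, 0, 0;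
        0, 0, 0, 1;
        0, 0, 0, 0])
  | .f43 =>
    (!![0, 1, 0, 0;
        0, 0, 0, 0;
        0, 0, 0, 0;
        0, 0, 0, 0],
     !![0, 0, 1, 0;
        0, 0, 0, 0;
        0, 0, 0, 0;
        0, 1, 0, 0])
  | .f51 =>
    (!![0, 0, 0, 0;
        0, 0, 0, 0;
        0, 0, 0, 0;
        0, 0, 0, 0],
     !![0, 1, 0, 0;
        0, 0, 1, 0;
        0, 0, 0, 1;
        0, 0, 0, 0])

end CommNilp

/-!
A pair of commuting nilpotent matrices is a module over `F[x, y]` on which `x` and `y` act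
nilpotently. Similarity is isomorphism of modules, and a pair is decomposable exactly when its
module is a nontrivial direct sum.

*Existence.* A first change of basis puts the first member `A` into Jordan form
(`exists_jordan_four_of_isNilpotent`). The second member `B` then runs through the nilpotent
elements of the centralizer of `A`, and is simplified by conjugating with invertible elements of
that centralizer.
* For the partition `4`, `B` is a polynomial in `A`.
* For `3 + 1`, two scalars `c` and `d` link the two blocks: the pair splits if both vanish, and
  the remaining parameter is absorbed into a basis vector otherwise.
* For `2 + 2`, `B` is a `2 × 2` matrix `M + x N` over `F[x]/(x²)` (`dualMatrix`). If `M = 0`, the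
  Jordan form of `N` decides, and this is where algebraic closedness is used essentially. If
  `M ≠ 0`, the matrix is cyclic over `F[x]/(x²)`, hence similar to a companion matrix.
* For `2 + 1 + 1`, `B` induces a nilpotent `2 × 2` matrix on `ker A / im A` (`hookMatrix`), whose
  Jordan form decides between the families `f41`, `f42` and the family `f43`.
* For `A = 0`, the Jordan form of `B` is the answer.

*Uniqueness.* Similarity extends to an automorphism of the matrix algebra
(`Similar.exists_algEquiv`), so similar pairs satisfy the same polynomial relations. The relations
`A³ = 0`, `A² = 0`, `A = 0`, `A B = 0`, `B² = 0` separate the families except for three pairs of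
families, and the parameters are the coefficients of relations such as `B² = μ A B + λ A`. The
exceptions, and the parameter of `f32`, are settled by comparing images, kernels or ranks.

*Indecomposability.* A decomposition yields a nontrivial idempotent commuting with `A` and `B`.
For each canonical form, every matrix commuting with both members is a scalar plus a nilpotent
matrix (`CanonicalForm.not_isDecomposable_toPair`), so that no such idempotent exists.
-/

namespace CommNilp

open Matrix

/-! ### Similarity of pairs -/

section Similarity

variable {n : ℕ} {F : Type*} [Field F]

theorem similar_iff {P Q : MatPair n F} :
    Similar P Q ↔ ∃ X : GL (Fin n) F, P.1 * X.val = X.val * Q.1 ∧ P.2 * X.val = X.val * Q.2 := by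
  have key : ∀ (X : GL (Fin n) F) (A C : Matrix (Fin n) (Fin n) F),
      (X⁻¹).val * A * X.val = C ↔ A * X.val = X.val * C := by
    intro X A C
    rw [mul_assoc, Units.inv_mul_eq_iff_eq_mul]
  simp only [Similar, key]

theorem Similar.symm {P Q : MatPair n F} (h : Similar P Q) : Similar Q P := by
  obtain ⟨X, h1, h2⟩ := h
  refine ⟨X⁻¹, ?_, ?_⟩
  · rw [← h1]; simp [mul_assoc]
  · rw [← h2]; simp [mul_assoc]

theorem Similar.trans {P Q R : MatPair n F} (h : Similar P Q) (h' : Similar Q R) :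
    Similar P R := by
  obtain ⟨X, h1, h2⟩ := h
  obtain ⟨Y, h3, h4⟩ := h'
  refine ⟨X * Y, ?_, ?_⟩
  · rw [← h3, ← h1]; simp [mul_assoc]
  · rw [← h4, ← h2]; simp [mul_assoc]

/-- Conjugation by the transition matrix is an algebra automorphism, so similar pairs satisfy the
same polynomial relations. -/
theorem Similar.exists_algEquiv {P Q : MatPair n F} (h : Similar P Q) :
    ∃ σ : Matrix (Fin n) (Fin n) F ≃ₐ[F] Matrix (Fin n) (Fin n) F, σ P.1 = Q.1 ∧ σ P.2 = Q.2 := by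
  obtain ⟨X, h1, h2⟩ := h
  refine ⟨MulSemiringAction.toAlgEquiv F _ (ConjAct.toConjAct X⁻¹), ?_, ?_⟩
  · simpa [ConjAct.units_smul_def] using h1
  · simpa [ConjAct.units_smul_def] using h2

theorem IsCommutingNilpotent.of_similar {P Q : MatPair n F} (hP : IsCommutingNilpotent P)
    (h : Similar P Q) : IsCommutingNilpotent Q := by
  obtain ⟨σ, h1, h2⟩ := h.exists_algEquiv
  obtain ⟨hA, hB, hAB⟩ := hP
  refine ⟨h1 ▸ hA.map σ, h2 ▸ hB.map σ, ?_⟩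
  rw [← h1, ← h2, ← map_mul, hAB, map_mul]

theorem IsDecomposable.of_similar {P Q : MatPair n F} (hQ : IsDecomposable Q)
    (h : Similar P Q) : IsDecomposable P := by
  obtain ⟨p, q, e, hp, hq, A₁, B₁, A₂, B₂, hs⟩ := hQ
  exact ⟨p, q, e, hp, hq, A₁, B₁, A₂, B₂, h.trans hs⟩

/-- A common change of basis extends a similarity of the first members to the whole pairs. -/
theorem exists_similar_of_fst (P : MatPair n F) {C : Matrix (Fin n) (Fin n) F}
    (h : ∃ X : GL (Fin n) F, P.1 * X.val = X.val * C) : ∃ D, Similar P (C, D) := by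
  obtain ⟨X, h⟩ := h
  refine ⟨(X⁻¹).val * P.2 * X.val, similar_iff.2 ⟨X, h, ?_⟩⟩
  simp [← mul_assoc]

theorem similar_of_mul_eq_one {P Q : MatPair n F} (X Y : Matrix (Fin n) (Fin n) F)
    (h : X * Y = 1) (h1 : P.1 * X = X * Q.1) (h2 : P.2 * X = X * Q.2) : Similar P Q :=
  similar_iff.2 ⟨⟨X, Y, h, mul_eq_one_comm.1 h⟩, h1, h2⟩

/-- If `A` acts on a linearly independent family `v` of full size by the coefficients of `C`, then
the matrix with columns `v j` conjugates `A` to `C`. -/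
theorem exists_GL_of_linearIndependent {A C : Matrix (Fin n) (Fin n) F} (v : Fin n → Fin n → F)
    (hv : LinearIndependent F v) (h : ∀ j, A *ᵥ v j = ∑ i, C i j • v i) :
    ∃ X : GL (Fin n) F, A * X.val = X.val * C := by
  have hu : IsUnit (Matrix.of v)ᵀ := linearIndependent_cols_iff_isUnit.1 hv
  refine ⟨hu.unit, ?_⟩
  ext i j
  have := congrFun (h j) i
  simpa [Matrix.mul_apply, Matrix.mulVec, dotProduct, mul_comm] using this

theorem pow_card_eq_zero_of_isNilpotent {A : Matrix (Fin n) (Fin n) F} (h : IsNilpotent A) :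
    A ^ n = 0 := by
  have h1 := Matrix.isNilpotent_charpoly_sub_pow_of_isNilpotent h
  have h2 : A.charpoly = Polynomial.X ^ n := by
    simpa [sub_eq_zero] using h1.eq_zero
  simpa [h2] using A.aeval_self_charpoly

end Similarity

/-! ### Decompositions, blocks and idempotents -/

section Decomposability

variable {n : ℕ} {F : Type*} [Field F]

theorem isDecomposable_of_blocks {p q : ℕ} (hp : 0 < p) (hq : 0 < q) (P : MatPair (p + q) F)
    (h₁ : ∀ i j, P.1 (Fin.castAdd q i) (Fin.natAdd p j) = 0)
    (h₂ : ∀ i j, P.1 (Fin.natAdd p i) (Fin.castAdd q j) = 0)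
    (h₃ : ∀ i j, P.2 (Fin.castAdd q i) (Fin.natAdd p j) = 0)
    (h₄ : ∀ i j, P.2 (Fin.natAdd p i) (Fin.castAdd q j) = 0) : IsDecomposable P := by
  have key : ∀ M : Matrix (Fin (p + q)) (Fin (p + q)) F,
      (∀ i j, M (Fin.castAdd q i) (Fin.natAdd p j) = 0) →
      (∀ i j, M (Fin.natAdd p i) (Fin.castAdd q j) = 0) →
      M = blockDiag rfl (M.submatrix (Fin.castAdd q) (Fin.castAdd q))
        (M.submatrix (Fin.natAdd p) (Fin.natAdd p)) := by
    intro M h h'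
    ext i j
    refine Fin.addCases (fun i => ?_) (fun i => ?_) i <;>
      refine Fin.addCases (fun j => ?_) (fun j => ?_) j <;>
      simp [blockDiag, h, h']
  exact ⟨p, q, rfl, hp, hq, _, _, _, _, 1, by simpa using key _ h₁ h₂, by simpa using key _ h₃ h₄⟩

/-- A decomposition of a pair yields a nontrivial idempotent commuting with both members: the
projection onto the first summand. -/
theorem IsDecomposable.exists_idempotent {P : MatPair n F} (h : IsDecomposable P) :
    ∃ E : Matrix (Fin n) (Fin n) F, IsIdempotentElem E ∧ E ≠ 0 ∧ E ≠ 1 ∧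
      Commute E P.1 ∧ Commute E P.2 := by
  obtain ⟨p, q, rfl, hp, hq, A₁, B₁, A₂, B₂, hs⟩ := h
  obtain ⟨σ, h1, h2⟩ := hs.symm.exists_algEquiv
  let ρ := Matrix.reindexAlgEquiv F F (finSumFinEquiv.trans (finCongr (rfl : p + q = p + q)))
  have hρ : ∀ (M : Matrix (Fin p) (Fin p) F) (N : Matrix (Fin q) (Fin q) F),
    blockDiag rfl M N = ρ (fromBlocks M 0 0 N) := fun _ _ => rfl
  simp only [hρ] at h1 h2
  have : NeZero p := ⟨hp.ne'⟩
  have : NeZero q := ⟨hq.ne'⟩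
  refine ⟨σ (ρ (fromBlocks 1 0 0 0)), ?_, ?_, ?_, ?_, ?_⟩
  · simp [IsIdempotentElem, ← map_mul, fromBlocks_multiply]
  · intro h0
    have h3 : fromBlocks (1 : Matrix (Fin p) (Fin p) F) 0 0 (0 : Matrix (Fin q) (Fin q) F) = 0 := by
      simpa using h0
    simpa using congrFun₂ h3 (Sum.inl 0) (Sum.inl 0)
  · intro h0
    have h3 : fromBlocks (1 : Matrix (Fin p) (Fin p) F) 0 0 (0 : Matrix (Fin q) (Fin q) F) = 1 := by
      apply ρ.injective
      apply σ.injective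
      simpa using h0
    simpa using congrFun₂ h3 (Sum.inr 0) (Sum.inr 0)
  · rw [← h1]
    simp [Commute, SemiconjBy, ← map_mul, fromBlocks_multiply]
  · rw [← h2]
    simp [Commute, SemiconjBy, ← map_mul, fromBlocks_multiply]

/-- If every matrix commuting with both members is a scalar plus a nilpotent matrix, then it is
either invertible or nilpotent, and an idempotent is therefore `0` or `1`. -/
theorem not_isDecomposable_of_commute {P : MatPair n F}
    (h : ∀ E, Commute E P.1 → Commute E P.2 → ∃ a : F, IsNilpotent (E - a • 1)) :
    ¬ IsDecomposable P := by
  intro hd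
  obtain ⟨E, hE, h0, h1, hA, hB⟩ := hd.exists_idempotent
  obtain ⟨a, ha⟩ := h E hA hB
  by_cases h2 : a = 0
  · subst h2
    obtain ⟨k, hk⟩ := ha
    rw [zero_smul, sub_zero] at hk
    rcases k with _ | k
    · apply h0
      rw [← mul_one E, ← pow_zero E, hk, mul_zero]
    · exact h0 (by rw [← hE.pow_succ_eq k, hk])
  · apply h1
    have hu : IsUnit (a • (1 : Matrix (Fin n) (Fin n) F)) := by
      simpa [Algebra.algebraMap_eq_smul_one] using
        (IsUnit.mk0 a h2).map (algebraMap F (Matrix (Fin n) (Fin n) F))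
    have hc : Commute (E - a • 1) (a • (1 : Matrix (Fin n) (Fin n) F)) :=
      (Commute.one_right _).smul_right a
    have hEu : IsUnit E := by
      simpa using ha.isUnit_add_right_of_commute hu hc
    exact hEu.mul_left_cancel (by rw [hE.eq, mul_one])

end Decomposability

/-! ### Jordan forms of small matrices -/

section NormalForms

variable {F : Type*} [Field F]

theorem exists_jordan_two [IsAlgClosed F] (M : Matrix (Fin 2) (Fin 2) F) :
    ∃ Q : GL (Fin 2) F, (∃ a d, M * Q.val = Q.val * !![a, 0; 0, d]) ∨
      ∃ a, M * Q.val = Q.val * !![a, 1; 0, a] := by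
  obtain ⟨a, ha⟩ := Module.End.exists_eigenvalue (Matrix.toLin' M)
  obtain ⟨v, hv⟩ := ha.exists_hasEigenvector
  have hv0 : v ≠ 0 := hv.2
  have hMv : M *ᵥ v = a • v := by simpa using hv.apply_eq_smul
  obtain ⟨w, hw⟩ : ∃ w, LinearIndependent F ![v, w] :=
    exists_linearIndependent_pair_of_one_lt_finrank (by simp) hv0
  have hmem : ∀ x, ∃ b d : F, x = b • v + d • w := by
    intro x
    let e := basisOfLinearIndependentOfCardEqFinrank hw (by simp)
    refine ⟨e.repr x 0, e.repr x 1, ?_⟩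
    have := e.sum_repr x
    simpa [Fin.sum_univ_two, e] using this.symm
  obtain ⟨b, d, hMw⟩ := hmem (M *ᵥ w)
  have hli := LinearIndependent.pair_iff.1 hw
  by_cases had : a = d
  · subst had
    by_cases hb : b = 0
    · subst hb
      obtain ⟨Q, hQ⟩ := exists_GL_of_linearIndependent (A := M) (C := !![a, 0; 0, a]) _ hw (by
        intro j
        fin_cases j <;> simp [hMv, hMw])
      exact ⟨Q, Or.inl ⟨a, a, hQ⟩⟩
    · have hw' : LinearIndependent F ![b • v, w] := by
        rw [LinearIndependent.pair_iff]
        intro s t hst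
        have := hli (s * b) t (by rw [← hst, smul_smul])
        simpa [hb] using this
      obtain ⟨Q, hQ⟩ := exists_GL_of_linearIndependent (A := M) (C := !![a, 1; 0, a]) _ hw' (by
        intro j
        fin_cases j <;> simp [hMv, hMw, mulVec_smul, smul_smul, mul_comm])
      exact ⟨Q, Or.inr ⟨a, hQ⟩⟩
  · have hda : d - a ≠ 0 := sub_ne_zero.2 (Ne.symm had)
    have hw' : LinearIndependent F ![v, w + (b / (d - a)) • v] := by
      rw [LinearIndependent.pair_iff]
      intro s t hst
      have := hli (s + t * (b / (d - a))) t (by rw [← hst]; module)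
      obtain ⟨h1, rfl⟩ := this
      simpa using h1
    obtain ⟨Q, hQ⟩ := exists_GL_of_linearIndependent (A := M) (C := !![a, 0; 0, d]) _ hw' (by
      intro j
      fin_cases j
      · simp [hMv]
      · have : d * (b / (d - a)) = b + b / (d - a) * a := by field_simp; ring
        simp only [Fin.mk_one, Fin.sum_univ_two]
        simp [mulVec_add, hMw, hMv, mulVec_smul, smul_smul, this]
        module)
    exact ⟨Q, Or.inl ⟨a, d, hQ⟩⟩

theorem exists_jordan_two_of_isNilpotent [IsAlgClosed F] {M : Matrix (Fin 2) (Fin 2) F}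
    (hM : IsNilpotent M) : M = 0 ∨ ∃ Q : GL (Fin 2) F, M * Q.val = Q.val * !![0, 1; 0, 0] := by
  have key : ∀ (Q : GL (Fin 2) F) C, M * Q.val = Q.val * C → C ^ 2 = 0 := by
    intro Q C h
    apply pow_card_eq_zero_of_isNilpotent
    rw [← Units.inv_mul_eq_iff_eq_mul, ← mul_assoc] at h
    rw [← h]
    obtain ⟨k, hk⟩ := hM
    exact ⟨k, by rw [Units.conj_pow', hk]; simp⟩
  obtain ⟨Q, ⟨a, d, h⟩ | ⟨a, h⟩⟩ := exists_jordan_two M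
  · have h2 := key Q _ h
    have ha : a = 0 := by simpa [pow_two] using congrFun₂ h2 0 0
    have hd : d = 0 := by simpa [pow_two] using congrFun₂ h2 1 1
    have h0 : !![(0 : F), 0; 0, 0] = 0 := by
      ext i j; fin_cases i <;> fin_cases j <;> rfl
    left
    subst ha hd
    rw [h0, mul_zero] at h
    simpa using h
  · have h2 := key Q _ h
    have ha : a = 0 := by simpa [pow_two] using congrFun₂ h2 0 0
    subst ha
    exact Or.inr ⟨Q, h⟩

/-- The Jordan normal forms of nilpotent `4 × 4` matrices, by the partitions `4`, `3 + 1`, `2 + 2`,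
`2 + 1 + 1` and `1 + 1 + 1 + 1`. -/
theorem exists_jordan_four_of_isNilpotent {A : Matrix (Fin 4) (Fin 4) F} (hA : IsNilpotent A) :
    (∃ X : GL (Fin 4) F, A * X.val =
      X.val * !![0, 1, 0, 0; 0, 0, 1, 0; 0, 0, 0, 1; 0, 0, 0, 0]) ∨
    (∃ X : GL (Fin 4) F, A * X.val =
      X.val * !![0, 1, 0, 0; 0, 0, 1, 0; 0, 0, 0, 0; 0, 0, 0, 0]) ∨
    (∃ X : GL (Fin 4) F, A * X.val =
      X.val * !![0, 1, 0, 0; 0, 0, 0, 0; 0, 0, 0, 1; 0, 0, 0, 0]) ∨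
    (∃ X : GL (Fin 4) F, A * X.val =
      X.val * !![0, 1, 0, 0; 0, 0, 0, 0; 0, 0, 0, 0; 0, 0, 0, 0]) ∨
    A = 0 := by
  have hA4 := pow_card_eq_zero_of_isNilpotent hA
  have h4 : ∀ x, A *ᵥ A *ᵥ A *ᵥ A *ᵥ x = 0 := by
    intro x
    simp only [mulVec_mulVec]
    rw [show A * (A * (A * A)) = A ^ 4 by noncomm_ring, hA4, zero_mulVec]
  by_cases h3 : ∀ x, A *ᵥ A *ᵥ A *ᵥ x = 0
  swap
  · push Not at h3
    obtain ⟨v, hv⟩ := h3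
    left
    refine exists_GL_of_linearIndependent ![A *ᵥ A *ᵥ A *ᵥ v, A *ᵥ A *ᵥ v, A *ᵥ v, v] ?_ ?_
    · rw [Fintype.linearIndependent_iff]
      intro g hg
      simp [-mulVec_mulVec, Fin.sum_univ_four] at hg
      have e3 := congrArg (fun x => A *ᵥ A *ᵥ A *ᵥ x) hg
      simp [-mulVec_mulVec, mulVec_add, mulVec_smul, h4, hv] at e3
      have e2 := congrArg (fun x => A *ᵥ A *ᵥ x) hg
      simp [-mulVec_mulVec, mulVec_add, mulVec_smul, h4, hv, e3] at e2
      have e1 := congrArg (fun x => A *ᵥ x) hg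
      simp [-mulVec_mulVec, mulVec_add, mulVec_smul, h4, hv, e3, e2] at e1
      simp [-mulVec_mulVec, e3, e2, e1, hv] at hg
      intro i
      fin_cases i <;> assumption
    · intro j
      fin_cases j <;> simp [-mulVec_mulVec, Fin.sum_univ_four, h4]
  right
  by_cases h2 : ∀ x, A *ᵥ A *ᵥ x = 0
  swap
  · push Not at h2
    obtain ⟨v, hv⟩ := h2
    left
    obtain ⟨k, hk⟩ := Function.ne_iff.1 hv
    rw [Pi.zero_apply] at hk
    -- The common kernel of the functionals `x ↦ (Aⁱ x) k` with `i < 3` is stable under `A` and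
    -- complementary to the cyclic subspace generated by `v`.
    let φ : (Fin 4 → F) →ₗ[F] (Fin 3 → F) := LinearMap.pi ![LinearMap.proj k,
      LinearMap.proj k ∘ₗ A.mulVecLin, LinearMap.proj k ∘ₗ A.mulVecLin ∘ₗ A.mulVecLin]
    obtain ⟨w, hw, hw0⟩ := φ.ker.exists_mem_ne_zero_of_ne_bot
      (φ.ker_ne_bot_of_finrank_lt (by simp))
    rw [LinearMap.mem_ker] at hw
    have w0 : w k = 0 := congrFun hw 0
    have w1 : (A *ᵥ w) k = 0 := congrFun hw 1
    have w2 : (A *ᵥ A *ᵥ w) k = 0 := congrFun hw 2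
    have hli : LinearIndependent F ![A *ᵥ A *ᵥ v, A *ᵥ v, v, w] := by
      rw [Fintype.linearIndependent_iff]
      intro g hg
      simp [-mulVec_mulVec, Fin.sum_univ_four] at hg
      have e2 := congrFun (congrArg (fun x => A *ᵥ A *ᵥ x) hg) k
      simp [-mulVec_mulVec, mulVec_add, mulVec_smul, h3, hk, w2] at e2
      have e1 := congrFun (congrArg (fun x => A *ᵥ x) hg) k
      simp [-mulVec_mulVec, mulVec_add, mulVec_smul, h3, hk, w1, e2] at e1
      have e0 := congrFun hg k
      simp [-mulVec_mulVec, hk, w0, e1, e2] at e0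
      simp [-mulVec_mulVec, e0, e2, e1, hw0] at hg
      intro i
      fin_cases i <;> assumption
    have hAw : A *ᵥ w = 0 := by
      let e := basisOfLinearIndependentOfCardEqFinrank hli (by simp)
      have hs := e.sum_repr (A *ᵥ w)
      generalize e.repr (A *ᵥ w) = g at hs
      simp [-mulVec_mulVec, Fin.sum_univ_four, e] at hs
      have e2 := congrFun (congrArg (fun x => A *ᵥ A *ᵥ x) hs) k
      simp [-mulVec_mulVec, mulVec_add, mulVec_smul, h3, hk, w2] at e2
      have e1 := congrFun (congrArg (fun x => A *ᵥ x) hs) k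
      simp [-mulVec_mulVec, mulVec_add, mulVec_smul, h3, hk, w1, w2, e2] at e1
      have e0 := congrFun hs k
      simp [-mulVec_mulVec, hk, w0, w1, e1, e2] at e0
      simp [-mulVec_mulVec, e0, e1, e2] at hs
      have := h3 w
      simpa [-mulVec_mulVec, ← hs, mulVec_smul, hw0] using this
    refine exists_GL_of_linearIndependent _ hli ?_
    intro j
    fin_cases j <;> simp [-mulVec_mulVec, Fin.sum_univ_four, h3, hAw]
  right
  by_cases hr : ∃ v w, LinearIndependent F ![A *ᵥ v, A *ᵥ w]
  · obtain ⟨v, w, hvw⟩ := hr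
    rw [LinearIndependent.pair_iff] at hvw
    left
    refine exists_GL_of_linearIndependent ![A *ᵥ v, v, A *ᵥ w, w] ?_ ?_
    · rw [Fintype.linearIndependent_iff]
      intro g hg
      simp [-mulVec_mulVec, Fin.sum_univ_four] at hg
      have e1 := congrArg (fun x => A *ᵥ x) hg
      simp [-mulVec_mulVec, mulVec_add, mulVec_smul, h2] at e1
      obtain ⟨e1, e3⟩ := hvw _ _ e1
      simp [-mulVec_mulVec, e1, e3] at hg
      obtain ⟨e0, e2⟩ := hvw _ _ hg
      intro i
      fin_cases i <;> assumption
    · intro j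
      fin_cases j <;> simp [-mulVec_mulVec, Fin.sum_univ_four, h2]
  right
  by_cases h1 : ∀ x, A *ᵥ x = 0
  · right
    ext i j
    simpa using congrFun (h1 (Pi.single j 1)) i
  · left
    push Not at h1
    obtain ⟨v, hv⟩ := h1
    obtain ⟨k, hk⟩ := Function.ne_iff.1 hv
    rw [Pi.zero_apply] at hk
    let φ : (Fin 4 → F) →ₗ[F] (Fin 2 → F) := LinearMap.pi ![LinearMap.proj k,
      LinearMap.proj k ∘ₗ A.mulVecLin]
    -- The image of `A` is spanned by `A v`, so `A` kills the kernel of `φ`.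
    have hker : ∀ w, φ w = 0 → w k = 0 ∧ A *ᵥ w = 0 := by
      intro w hw
      have w0 : w k = 0 := congrFun hw 0
      have w1 : (A *ᵥ w) k = 0 := congrFun hw 1
      refine ⟨w0, ?_⟩
      have hd : ¬ LinearIndependent F ![A *ᵥ v, A *ᵥ w] := fun h => hr ⟨v, w, h⟩
      rw [LinearIndependent.pair_iff' hv] at hd
      push Not at hd
      obtain ⟨c, hc⟩ := hd
      rw [← hc] at w1 ⊢
      have : c = 0 := by simpa [-mulVec_mulVec, hk] using w1
      simp [-mulVec_mulVec, this]
    have hfin : 2 ≤ Module.finrank F φ.ker := by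
      have h1 := φ.finrank_range_add_finrank_ker
      have h2 := φ.range.finrank_le
      simp at h1 h2
      omega
    obtain ⟨f, hf⟩ := exists_linearIndependent_of_le_finrank hfin
    have hli := Fintype.linearIndependent_iff.1 (hf.map' φ.ker.subtype (Submodule.ker_subtype _))
    simp only [Fin.sum_univ_two, Function.comp_apply, Submodule.subtype_apply] at hli
    obtain ⟨u0, hu⟩ := hker (f 0) (f 0).2
    obtain ⟨w0, hw⟩ := hker (f 1) (f 1).2
    refine exists_GL_of_linearIndependent ![A *ᵥ v, v, f 0, f 1] ?_ ?_
    · rw [Fintype.linearIndependent_iff]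
      intro g hg
      simp [-mulVec_mulVec, Fin.sum_univ_four] at hg
      have e1 := congrArg (fun x => A *ᵥ x) hg
      simp [-mulVec_mulVec, mulVec_add, mulVec_smul, h2, hu, hw, hv] at e1
      have e0 := congrFun hg k
      simp [e1, u0, w0, hk] at e0
      simp [e0, e1] at hg
      have := hli ![g 2, g 3] (by simpa using hg)
      have e2 := this 0
      have e3 := this 1
      intro i
      fin_cases i <;> assumption
    · intro j
      fin_cases j <;> simp [-mulVec_mulVec, Fin.sum_univ_four, h2, hu, hw]

end NormalForms

/-! ### First member of Jordan type `4` or `3 + 1` -/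

section Large

variable {F : Type*} [Field F]

/-- The second member commutes with a single Jordan block, so it is a polynomial in that block, and
nilpotency removes the constant term. -/
theorem exists_form_of_jordan_four {D : Matrix (Fin 4) (Fin 4) F}
    (h : IsCommutingNilpotent (!![0, 1, 0, 0; 0, 0, 1, 0; 0, 0, 0, 1; 0, 0, 0, 0], D)) :
    ∃ l m v, (!![0, 1, 0, 0; 0, 0, 1, 0; 0, 0, 0, 1; 0, 0, 0, 0], D) =
      (CanonicalForm.f11 l m v : CanonicalForm F).toPair := by
  obtain ⟨-, hD, hc⟩ := h
  have hD4 := pow_card_eq_zero_of_isNilpotent hD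
  dsimp only at hc hD4
  have e := fun i j => congrFun₂ hc i j
  simp [Matrix.mul_apply, Fin.sum_univ_four, Fin.forall_fin_succ] at e
  obtain ⟨a, l, m, v, rfl⟩ : ∃ a l m v, D = !![a, l, m, v; 0, a, l, m; 0, 0, a, l; 0, 0, 0, a] := by
    refine ⟨D 0 0, D 0 1, D 0 2, D 0 3, ?_⟩
    ext i j
    fin_cases i <;> fin_cases j <;> simp <;> grind
  obtain rfl : a = 0 := by
    have := congrFun₂ hD4 0 0
    simpa [pow_succ, Matrix.mul_apply, Fin.sum_univ_four] using this
  exact ⟨l, m, v, rfl⟩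

/-- Here the second member is
`!![0, l, k, c; 0, 0, l, 0; 0, 0, 0, 0; 0, 0, d, 0]`. If `d ≠ 0`, then `d e₄ + k e₁` can replace
`e₄`; if `d = 0` and `c ≠ 0`, then `e₃ - (k / c) e₄` can replace `e₃`. -/
theorem isDecomposable_or_exists_form_of_jordan_three_one {D : Matrix (Fin 4) (Fin 4) F}
    (h : IsCommutingNilpotent (!![0, 1, 0, 0; 0, 0, 1, 0; 0, 0, 0, 0; 0, 0, 0, 0], D)) :
    IsDecomposable (!![0, 1, 0, 0; 0, 0, 1, 0; 0, 0, 0, 0; 0, 0, 0, 0], D) ∨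
    ∃ c : CanonicalForm F,
      Similar (!![0, 1, 0, 0; 0, 0, 1, 0; 0, 0, 0, 0; 0, 0, 0, 0], D) c.toPair := by
  obtain ⟨-, hD, hc⟩ := h
  have hD4 := pow_card_eq_zero_of_isNilpotent hD
  dsimp only at hc hD4
  have e := fun i j => congrFun₂ hc i j
  simp [Matrix.mul_apply, Fin.sum_univ_four, Fin.forall_fin_succ] at e
  obtain ⟨a, l, k, c, d, b, rfl⟩ : ∃ a l k c d b,
      D = !![a, l, k, c; 0, a, l, 0; 0, 0, a, 0; 0, 0, d, b] := by
    refine ⟨D 0 0, D 0 1, D 0 2, D 0 3, D 3 2, D 3 3, ?_⟩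
    ext i j
    fin_cases i <;> fin_cases j <;> simp <;> grind
  obtain rfl : a = 0 := by
    have := congrFun₂ hD4 0 0
    simpa [pow_succ, Matrix.mul_apply, Fin.sum_univ_four] using this
  obtain rfl : b = 0 := by
    have := congrFun₂ hD4 3 3
    simpa [pow_succ, Matrix.mul_apply, Fin.sum_univ_four] using this
  by_cases hd : d = 0
  · subst hd
    by_cases h0 : c = 0
    · subst h0
      left
      apply isDecomposable_of_blocks (p := 3) (q := 1) (by norm_num) (by norm_num) <;>
        intro i j <;> fin_cases i <;> fin_cases j <;> rfl
    · right
      refine ⟨.f22 l, similar_of_mul_eq_one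
        !![1, 0, 0, 0; 0, 1, 0, 0; 0, 0, 1, 0; 0, 0, -k / c, 1 / c]
        !![1, 0, 0, 0; 0, 1, 0, 0; 0, 0, 1, 0; 0, 0, k, c] ?_ ?_ ?_⟩ <;>
      ext i j <;> fin_cases i <;> fin_cases j <;>
        simp [CanonicalForm.toPair, Matrix.mul_apply, Fin.sum_univ_four] <;> (field_simp; try ring)
  · right
    refine ⟨.f21 l (c * d), similar_of_mul_eq_one
        !![1, 0, 0, k; 0, 1, 0, 0; 0, 0, 1, 0; 0, 0, 0, d]
        !![1, 0, 0, -k / d; 0, 1, 0, 0; 0, 0, 1, 0; 0, 0, 0, 1 / d] ?_ ?_ ?_⟩ <;>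
      ext i j <;> fin_cases i <;> fin_cases j <;>
        simp [CanonicalForm.toPair, Matrix.mul_apply, Fin.sum_univ_four] <;> (field_simp; try ring)

end Large

/-! ### First member of Jordan type `2 + 2` -/

section TwoTwo

variable {F : Type*} [Field F]

/-- The `4 × 4` matrix over `F` of the `2 × 2` matrix `M + x N` over `F[x]/(x²)`, in the basis
`x f₁, f₁, x f₂, f₂`. These matrices make up the centralizer of `dualMatrix 0 1`, a sum of two
nilpotent Jordan blocks of size two. -/
def dualMatrix (M N : Matrix (Fin 2) (Fin 2) F) : Matrix (Fin 4) (Fin 4) F :=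
  !![M 0 0, N 0 0, M 0 1, N 0 1;
     0, M 0 0, 0, M 0 1;
     M 1 0, N 1 0, M 1 1, N 1 1;
     0, M 1 0, 0, M 1 1]

theorem dualMatrix_mul (M N M' N' : Matrix (Fin 2) (Fin 2) F) :
    dualMatrix M N * dualMatrix M' N' = dualMatrix (M * M') (M * N' + N * M') := by
  ext i j
  fin_cases i <;> fin_cases j <;>
    simp [dualMatrix, Matrix.mul_apply, Fin.sum_univ_four, Fin.sum_univ_two] <;> ring

theorem dualMatrix_one_zero : dualMatrix (1 : Matrix (Fin 2) (Fin 2) F) 0 = 1 := by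
  ext i j
  fin_cases i <;> fin_cases j <;> simp [dualMatrix]

theorem dualMatrix_zero_one : dualMatrix (0 : Matrix (Fin 2) (Fin 2) F) 1 =
    !![0, 1, 0, 0; 0, 0, 0, 0; 0, 0, 0, 1; 0, 0, 0, 0] := by
  ext i j
  fin_cases i <;> fin_cases j <;> simp [dualMatrix]

theorem exists_eq_dualMatrix_of_commute {D : Matrix (Fin 4) (Fin 4) F}
    (h : dualMatrix 0 1 * D = D * dualMatrix 0 1) : ∃ M N, D = dualMatrix M N := by
  rw [dualMatrix_zero_one] at h
  have e := fun i j => congrFun₂ h i j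
  simp [Matrix.mul_apply, Fin.sum_univ_four, Fin.forall_fin_succ] at e
  refine ⟨!![D 0 0, D 0 2; D 2 0, D 2 2], !![D 0 1, D 0 3; D 2 1, D 2 3], ?_⟩
  ext i j
  fin_cases i <;> fin_cases j <;> simp [dualMatrix] <;> grind

theorem isNilpotent_of_dualMatrix {M N : Matrix (Fin 2) (Fin 2) F}
    (h : IsNilpotent (dualMatrix M N)) : IsNilpotent M := by
  obtain ⟨k, hk⟩ := h
  have hpow : ∀ k, ∃ N', dualMatrix M N ^ k = dualMatrix (M ^ k) N' := by
    intro k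
    induction k with
    | zero => exact ⟨0, by simp [dualMatrix_one_zero]⟩
    | succ k ih =>
      obtain ⟨N', h⟩ := ih
      exact ⟨_, by rw [pow_succ, h, dualMatrix_mul, pow_succ]⟩
  obtain ⟨N', h⟩ := hpow k
  rw [hk] at h
  refine ⟨k, ?_⟩
  ext i j
  have e := fun i j => congrFun₂ h i j
  simp [dualMatrix, Fin.forall_fin_succ] at e
  fin_cases i <;> fin_cases j <;> simp <;> grind

theorem similar_dualMatrix {M N C C' : Matrix (Fin 2) (Fin 2) F} (Q : GL (Fin 2) F)
    (h : M * Q.val = Q.val * C) (h' : N * Q.val = Q.val * C') :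
    Similar (dualMatrix 0 1, dualMatrix M N) (dualMatrix 0 1, dualMatrix C C') := by
  refine similar_of_mul_eq_one (dualMatrix Q.val 0) (dualMatrix (Q⁻¹).val 0) ?_ ?_ ?_ <;>
    simp [dualMatrix_mul, dualMatrix_one_zero, h, h']

theorem isDecomposable_or_exists_form_of_jordan_two_two [IsAlgClosed F]
    {D : Matrix (Fin 4) (Fin 4) F}
    (h : IsCommutingNilpotent (!![0, 1, 0, 0; 0, 0, 0, 0; 0, 0, 0, 1; 0, 0, 0, 0], D)) :
    IsDecomposable (!![0, 1, 0, 0; 0, 0, 0, 0; 0, 0, 0, 1; 0, 0, 0, 0], D) ∨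
    ∃ c : CanonicalForm F,
      Similar (!![0, 1, 0, 0; 0, 0, 0, 0; 0, 0, 0, 1; 0, 0, 0, 0], D) c.toPair := by
  rw [← dualMatrix_zero_one] at h ⊢
  obtain ⟨-, hD, hc⟩ := h
  obtain ⟨M, N, rfl⟩ := exists_eq_dualMatrix_of_commute hc
  obtain rfl | ⟨Q, hQ⟩ := exists_jordan_two_of_isNilpotent (isNilpotent_of_dualMatrix hD)
  · obtain ⟨Q, ⟨a, d, hQ⟩ | ⟨a, hQ⟩⟩ := exists_jordan_two N
    · left
      refine IsDecomposable.of_similar ?_ (similar_dualMatrix (C := 0) Q (by simp) hQ)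
      apply isDecomposable_of_blocks (p := 2) (q := 2) (by norm_num) (by norm_num) <;>
        intro i j <;> fin_cases i <;> fin_cases j <;> rfl
    · right
      refine ⟨.f32 a, (similar_dualMatrix (C := 0) Q (by simp) hQ).trans
        (similar_of_mul_eq_one 1 1 (mul_one 1) ?_ ?_)⟩ <;>
      ext i j <;> fin_cases i <;> fin_cases j <;> simp [dualMatrix, CanonicalForm.toPair]
  · right
    have hQ' : N * Q.val = Q.val * ((Q⁻¹).val * N * Q.val) := by simp [← mul_assoc]
    generalize (Q⁻¹).val * N * Q.val = C' at hQ'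
    -- The second member is cyclic over `F[x]/(x²)` with generator `f₂`, hence a companion matrix
    -- in a suitable basis.
    refine ⟨.f31 (C' 1 0) (C' 0 0 + C' 1 1), (similar_dualMatrix Q hQ hQ').trans
      (similar_of_mul_eq_one
        !![1, C' 0 1, 0, 0; 0, 1, 0, 0; 0, - C' 0 0, 1, 0; 0, 0, 0, 1]
        !![1, -C' 0 1, 0, 0; 0, 1, 0, 0; 0, C' 0 0, 1, 0; 0, 0, 0, 1] ?_ ?_ ?_)⟩ <;>
    ext i j <;> fin_cases i <;> fin_cases j <;>
      simp [dualMatrix, CanonicalForm.toPair, Matrix.mul_apply, Fin.sum_univ_four]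

end TwoTwo

/-! ### First member of Jordan type `2 + 1 + 1` -/

section TwoOneOne

variable {F : Type*} [Field F]

/-- A matrix commuting with the elementary matrix `e₂ ↦ e₁` and inducing `N` on the subquotient
`ker / im` of that elementary matrix. -/
def hookMatrix (a c d p q : F) (N : Matrix (Fin 2) (Fin 2) F) : Matrix (Fin 4) (Fin 4) F :=
  !![0, a, c, d;
     0, 0, 0, 0;
     0, p, N 0 0, N 0 1;
     0, q, N 1 0, N 1 1]

/-- If `e₄ ↦ e₃` on the subquotient, the pair is cyclic with generator `e₂` for `q ≠ 0`. For
`q = 0` and `c ≠ 0`, the image of `e₂` under the second member can be cleared, and for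
`q = c = 0` the spans of the first two and of the last two basis vectors separate. -/
theorem exists_form_of_hookMatrix_jordan (a c d p q : F) :
    IsDecomposable (!![0, 1, 0, 0; 0, 0, 0, 0; 0, 0, 0, 0; 0, 0, 0, 0],
      hookMatrix a c d p q !![0, 1; 0, 0]) ∨
    ∃ x : CanonicalForm F, Similar (!![0, 1, 0, 0; 0, 0, 0, 0; 0, 0, 0, 0; 0, 0, 0, 0],
      hookMatrix a c d p q !![0, 1; 0, 0]) x.toPair := by
  -- Subtracting `p e₄` from `e₂` leaves the coefficient `a - p d` of `e₁` in the image of `e₂`.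
  by_cases hq : q = 0
  · subst hq
    by_cases hc : c = 0
    · subst hc
      left
      have hs : Similar (!![0, 1, 0, 0; 0, 0, 0, 0; 0, 0, 0, 0; 0, 0, 0, 0],
          hookMatrix a 0 d p 0 !![0, 1; 0, 0])
          (!![0, 1, 0, 0; 0, 0, 0, 0; 0, 0, 0, 0; 0, 0, 0, 0],
          hookMatrix (a - p * d) 0 0 0 0 !![0, 1; 0, 0]) := by
        refine similar_of_mul_eq_one
          !![1, 0, d, 0; 0, 1, 0, 0; 0, 0, 1, 0; 0, -p, 0, 1]
          !![1, 0, -d, 0; 0, 1, 0, 0; 0, 0, 1, 0; 0, p, 0, 1] ?_ ?_ ?_ <;>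
        ext i j <;> fin_cases i <;> fin_cases j <;>
          simp [hookMatrix, Matrix.mul_apply, Fin.sum_univ_four] <;> ring
      refine IsDecomposable.of_similar ?_ hs
      apply isDecomposable_of_blocks (p := 2) (q := 2) (by norm_num) (by norm_num) <;>
        intro i j <;> fin_cases i <;> fin_cases j <;> rfl
    · right
      refine ⟨.f42, similar_of_mul_eq_one
        !![1, -(a - p * d) * d / c, d / c, 0; 0, 1, 0, 0; 0, -(a - p * d) / c, 1 / c, 0;
          0, -p, 0, 1 / c]
        !![1, 0, -d, 0; 0, 1, 0, 0; 0, a - p * d, c, 0; 0, p * c, 0, c] ?_ ?_ ?_⟩ <;>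
      ext i j <;> fin_cases i <;> fin_cases j <;>
        simp [hookMatrix, CanonicalForm.toPair, Matrix.mul_apply, Fin.sum_univ_four] <;>
        (field_simp; try ring)
  · right
    refine ⟨.f41 (q * c), similar_of_mul_eq_one
        !![1, 0, q * d, a - p * d; 0, 1, 0, 0; 0, 0, q, 0; 0, -p, 0, q]
        !![1, -(a - p * d) * p / q, -d, -(a - p * d) / q; 0, 1, 0, 0; 0, 0, 1 / q, 0;
          0, p / q, 0, 1 / q] ?_ ?_ ?_⟩ <;>
      ext i j <;> fin_cases i <;> fin_cases j <;>
        simp [hookMatrix, CanonicalForm.toPair, Matrix.mul_apply, Fin.sum_univ_four] <;>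
        (field_simp; try ring)

/-- Change of basis by `Q` in the span of `e₃` and `e₄`. -/
theorem similar_hookMatrix {a c d p q c' d' p' q' : F} {N C : Matrix (Fin 2) (Fin 2) F}
    (Q R : Matrix (Fin 2) (Fin 2) F) (hQR : Q * R = 1) (hN : N * Q = Q * C)
    (hcd : ![c, d] ᵥ* Q = ![c', d']) (hpq : ![p, q] = Q *ᵥ ![p', q']) :
    Similar (!![0, 1, 0, 0; 0, 0, 0, 0; 0, 0, 0, 0; 0, 0, 0, 0], hookMatrix a c d p q N)
      (!![0, 1, 0, 0; 0, 0, 0, 0; 0, 0, 0, 0; 0, 0, 0, 0], hookMatrix a c' d' p' q' C) := by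
  have e1 := fun i j => congrFun₂ hQR i j
  have e2 := fun i j => congrFun₂ hN i j
  have e3 := congrFun hcd
  have e4 := congrFun hpq
  simp [Matrix.mul_apply, Fin.forall_fin_two, vecMul, mulVec, dotProduct] at e1 e2 e3 e4
  refine similar_of_mul_eq_one
    !![1, 0, 0, 0; 0, 1, 0, 0; 0, 0, Q 0 0, Q 0 1; 0, 0, Q 1 0, Q 1 1]
    !![1, 0, 0, 0; 0, 1, 0, 0; 0, 0, R 0 0, R 0 1; 0, 0, R 1 0, R 1 1] ?_ ?_ ?_ <;>
  ext i j <;> fin_cases i <;> fin_cases j <;>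
    simp [hookMatrix, Matrix.mul_apply, Fin.sum_univ_four, e1, e2, e3, e4]

/-- The last basis vector spans a direct summand. -/
theorem isDecomposable_hookMatrix (a c p : F) :
    IsDecomposable (!![0, 1, 0, 0; 0, 0, 0, 0; 0, 0, 0, 0; 0, 0, 0, 0],
      hookMatrix a c 0 p 0 0) := by
  apply isDecomposable_of_blocks (p := 3) (q := 1) (by norm_num) (by norm_num) <;>
    intro i j <;> fin_cases i <;> fin_cases j <;> rfl

theorem exists_form_of_hookMatrix_one (a t : F) :
    IsDecomposable (!![0, 1, 0, 0; 0, 0, 0, 0; 0, 0, 0, 0; 0, 0, 0, 0],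
      hookMatrix a 1 0 0 t 0) ∨
    ∃ x : CanonicalForm F, Similar (!![0, 1, 0, 0; 0, 0, 0, 0; 0, 0, 0, 0; 0, 0, 0, 0],
      hookMatrix a 1 0 0 t 0) x.toPair := by
  by_cases ht : t = 0
  · subst ht
    exact Or.inl (isDecomposable_hookMatrix a 1 0)
  · right
    refine ⟨.f43, similar_of_mul_eq_one
        !![1, 0, 0, a; 0, 1, 0, 0; 0, 0, 1, 0; 0, 0, 0, t]
        !![1, 0, 0, -a / t; 0, 1, 0, 0; 0, 0, 1, 0; 0, 0, 0, 1 / t] ?_ ?_ ?_⟩ <;>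
    ext i j <;> fin_cases i <;> fin_cases j <;>
      simp [hookMatrix, CanonicalForm.toPair, Matrix.mul_apply, Fin.sum_univ_four] <;>
      (field_simp; try ring)

/-- The pairing of the functional `(c, d)` with the vector `(p, q)` decides whether the image of
`e₂` and the functional can be separated from a complementary direction. -/
theorem exists_form_of_hookMatrix_zero (a c d p q : F) :
    IsDecomposable (!![0, 1, 0, 0; 0, 0, 0, 0; 0, 0, 0, 0; 0, 0, 0, 0],
      hookMatrix a c d p q 0) ∨
    ∃ x : CanonicalForm F, Similar (!![0, 1, 0, 0; 0, 0, 0, 0; 0, 0, 0, 0; 0, 0, 0, 0],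
      hookMatrix a c d p q 0) x.toPair := by
  by_cases hs : c * p + d * q = 0
  swap
  · left
    refine (isDecomposable_hookMatrix a (c * p + d * q) 1).of_similar
      (similar_hookMatrix !![p, -d; q, c] ((c * p + d * q)⁻¹ • !![c, d; -q, p]) ?_ (by simp) ?_ ?_)
    · have h : !![p, -d; q, c] * !![c, d; -q, p] = (c * p + d * q) • 1 := by
        ext i j
        fin_cases i <;> fin_cases j <;> simp <;> ring
      rw [mul_smul_comm, h, smul_smul, inv_mul_cancel₀ hs, one_smul]
    · ext i
      fin_cases i <;> simp [vecMul, dotProduct]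
      ring
    · ext i
      fin_cases i <;> simp
  by_cases hc : c = 0
  · subst hc
    by_cases hd : d = 0
    · subst hd
      left
      by_cases hp : p = 0
      · subst hp
        refine (isDecomposable_hookMatrix a 0 q).of_similar
          (similar_hookMatrix !![0, 1; 1, 0] !![0, 1; 1, 0] ?_ (by simp) ?_ ?_)
        · ext i j
          fin_cases i <;> fin_cases j <;> simp
        · ext i
          fin_cases i <;> simp [vecMul, dotProduct]
        · ext i
          fin_cases i <;> simp
      · refine (isDecomposable_hookMatrix a 0 1).of_similar
          (similar_hookMatrix !![p, 0; q, 1] !![1 / p, 0; -q / p, 1] ?_ (by simp) ?_ ?_)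
        · ext i j
          fin_cases i <;> fin_cases j <;> simp <;> (field_simp; try ring)
        · ext i
          fin_cases i <;> simp [vecMul, dotProduct]
        · ext i
          fin_cases i <;> simp
    · have hq : q = 0 := by simpa [hd] using hs
      subst hq
      have h := similar_hookMatrix (a := a) (c := 0) (d := d) (p := p) (q := 0) (c' := 1)
        (d' := 0) (p' := 0) (q' := p) (N := 0) (C := 0) !![0, 1; 1 / d, 0] !![0, d; 1, 0]
        (by ext i j; fin_cases i <;> fin_cases j <;> simp [hd]) (by simp)
        (by ext i; fin_cases i <;> simp [vecMul, dotProduct, hd])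
        (by ext i; fin_cases i <;> simp)
      exact (exists_form_of_hookMatrix_one a p).imp (·.of_similar h)
        fun ⟨x, hx⟩ => ⟨x, h.trans hx⟩
  · have hp : p = -(d * (q / c)) := by
      field_simp
      linear_combination hs
    have h := similar_hookMatrix (a := a) (c := c) (d := d) (p := p) (q := q) (c' := 1)
      (d' := 0) (p' := 0) (q' := q / c) (N := 0) (C := 0) !![1 / c, -d; 0, c] !![c, d; 0, 1 / c]
      (by ext i j; fin_cases i <;> fin_cases j <;> simp [hc] <;> ring) (by simp)
      (by ext i; fin_cases i <;> simp [vecMul, dotProduct, hc]; ring)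
      (by ext i; fin_cases i <;> simp [hp] <;> field_simp)
    exact (exists_form_of_hookMatrix_one a _).imp (·.of_similar h)
      fun ⟨x, hx⟩ => ⟨x, h.trans hx⟩

theorem isDecomposable_or_exists_form_of_jordan_two_one_one [IsAlgClosed F]
    {D : Matrix (Fin 4) (Fin 4) F}
    (h : IsCommutingNilpotent (!![0, 1, 0, 0; 0, 0, 0, 0; 0, 0, 0, 0; 0, 0, 0, 0], D)) :
    IsDecomposable (!![0, 1, 0, 0; 0, 0, 0, 0; 0, 0, 0, 0; 0, 0, 0, 0], D) ∨
    ∃ c : CanonicalForm F,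
      Similar (!![0, 1, 0, 0; 0, 0, 0, 0; 0, 0, 0, 0; 0, 0, 0, 0], D) c.toPair := by
  obtain ⟨-, hD, hc⟩ := h
  have hD4 := pow_card_eq_zero_of_isNilpotent hD
  dsimp only at hc hD4
  have e := fun i j => congrFun₂ hc i j
  simp [Matrix.mul_apply, Fin.sum_univ_four, Fin.forall_fin_succ] at e
  have h00 : D 0 0 = 0 := by
    have h1 := congrFun₂ hD4 1 1
    simp [pow_succ, Matrix.mul_apply, Fin.sum_univ_four] at h1
    grind
  obtain ⟨a, c, d, p, q, N, rfl⟩ : ∃ a c d p q N, D = hookMatrix a c d p q N := by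
    refine ⟨D 0 1, D 0 2, D 0 3, D 2 1, D 3 1, !![D 2 2, D 2 3; D 3 2, D 3 3], ?_⟩
    ext i j
    fin_cases i <;> fin_cases j <;> simp [hookMatrix] <;> grind
  have hN : IsNilpotent N := by
    refine ⟨4, ?_⟩
    have e4 := fun i j => congrFun₂ hD4 i j
    simp [hookMatrix, pow_succ, Matrix.mul_apply, Fin.sum_univ_four, Fin.forall_fin_succ] at e4
    ext i j
    fin_cases i <;> fin_cases j <;>
      simp [pow_succ, Matrix.mul_apply, Fin.sum_univ_two] <;> grind
  obtain rfl | ⟨Q, hQ⟩ := exists_jordan_two_of_isNilpotent hN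
  · exact exists_form_of_hookMatrix_zero a c d p q
  · have h := similar_hookMatrix (a := a) (c := c) (d := d) (p := p) (q := q)
      (c' := (![c, d] ᵥ* Q.val) 0) (d' := (![c, d] ᵥ* Q.val) 1)
      (p' := ((Q⁻¹).val *ᵥ ![p, q]) 0) (q' := ((Q⁻¹).val *ᵥ ![p, q]) 1) Q.val (Q⁻¹).val
      (by simp) hQ (List.ofFn_inj.1 rfl) (by
        have : ![((Q⁻¹).val *ᵥ ![p, q]) 0, ((Q⁻¹).val *ᵥ ![p, q]) 1] = (Q⁻¹).val *ᵥ ![p, q] :=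
          List.ofFn_inj.1 rfl
        rw [this, mulVec_mulVec]
        simp)
    exact (exists_form_of_hookMatrix_jordan _ _ _ _ _).imp (·.of_similar h)
      fun ⟨x, hx⟩ => ⟨x, h.trans hx⟩

end TwoOneOne

/-! ### Existence of a canonical form -/

section Existence

variable {F : Type*} [Field F]

theorem isDecomposable_or_exists_form_of_zero {D : Matrix (Fin 4) (Fin 4) F}
    (hD : IsNilpotent D) :
    IsDecomposable (0, D) ∨ ∃ c : CanonicalForm F, Similar (0, D) c.toPair := by
  have key : ∀ C, (∃ X : GL (Fin 4) F, D * X.val = X.val * C) → Similar (0, D) (0, C) :=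
    fun C ⟨X, hX⟩ => similar_iff.2 ⟨X, by simp, hX⟩
  rcases exists_jordan_four_of_isNilpotent hD with h | h | h | h | rfl
  · right
    refine ⟨.f51, (key _ h).trans (similar_of_mul_eq_one 1 1 (mul_one 1) ?_ ?_)⟩ <;>
    ext i j <;> fin_cases i <;> fin_cases j <;> simp [CanonicalForm.toPair]
  · refine Or.inl (IsDecomposable.of_similar ?_ (key _ h))
    apply isDecomposable_of_blocks (p := 3) (q := 1) (by norm_num) (by norm_num) <;>
      intro i j <;> fin_cases i <;> fin_cases j <;> rfl
  · refine Or.inl (IsDecomposable.of_similar ?_ (key _ h))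
    apply isDecomposable_of_blocks (p := 2) (q := 2) (by norm_num) (by norm_num) <;>
      intro i j <;> fin_cases i <;> fin_cases j <;> rfl
  · refine Or.inl (IsDecomposable.of_similar ?_ (key _ h))
    apply isDecomposable_of_blocks (p := 3) (q := 1) (by norm_num) (by norm_num) <;>
      intro i j <;> fin_cases i <;> fin_cases j <;> rfl
  · left
    apply isDecomposable_of_blocks (p := 3) (q := 1) (by norm_num) (by norm_num) <;>
      intro i j <;> rfl

theorem isDecomposable_or_exists_form [IsAlgClosed F] {P : MatPair 4 F}
    (hP : IsCommutingNilpotent P) :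
    IsDecomposable P ∨ ∃ c : CanonicalForm F, Similar P c.toPair := by
  have key : ∀ C, (∃ X : GL (Fin 4) F, P.1 * X.val = X.val * C) →
      (∀ D, IsCommutingNilpotent (C, D) →
        IsDecomposable (C, D) ∨ ∃ c : CanonicalForm F, Similar (C, D) c.toPair) →
      IsDecomposable P ∨ ∃ c : CanonicalForm F, Similar P c.toPair := by
    intro C hX hC
    obtain ⟨D, hD⟩ := exists_similar_of_fst P hX
    exact (hC D (hP.of_similar hD)).imp (·.of_similar hD) fun ⟨c, hc⟩ => ⟨c, hD.trans hc⟩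
  rcases exists_jordan_four_of_isNilpotent hP.1 with h | h | h | h | h
  · refine key _ h fun D hD => Or.inr ?_
    obtain ⟨l, m, v, he⟩ := exists_form_of_jordan_four hD
    exact ⟨.f11 l m v, he ▸ ⟨1, by simp, by simp⟩⟩
  · exact key _ h fun D => isDecomposable_or_exists_form_of_jordan_three_one
  · exact key _ h fun D => isDecomposable_or_exists_form_of_jordan_two_two
  · exact key _ h fun D => isDecomposable_or_exists_form_of_jordan_two_one_one
  · obtain ⟨A, B⟩ := P
    subst h
    exact isDecomposable_or_exists_form_of_zero hP.2.1

end Existence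

/-! ### Indecomposability of the canonical forms -/

section Indecomposable

variable {F : Type*} [Field F]

/-- A matrix whose action strictly lowers a height function on the basis vectors is nilpotent. -/
theorem isNilpotent_of_height {n : ℕ} (M : Matrix (Fin n) (Fin n) F) (r : Fin n → ℕ)
    (h : ∀ i j, M i j ≠ 0 → r i < r j) : IsNilpotent M := by
  have key : ∀ k i j, (M ^ k) i j ≠ 0 → r i + k ≤ r j := by
    intro k
    induction k with
    | zero =>
      intro i j hij
      obtain rfl : i = j := by
        by_contra hne
        exact hij (by simp [hne])
      simp
    | succ k ih =>
      intro i j hij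
      rw [pow_succ, Matrix.mul_apply] at hij
      obtain ⟨l, -, hl⟩ := Finset.exists_ne_zero_of_sum_ne_zero hij
      have h1 := ih i l (left_ne_zero_of_mul hl)
      have h2 := h l j (right_ne_zero_of_mul hl)
      omega
  refine ⟨∑ i, r i + 1, ?_⟩
  ext i j
  by_contra hij
  have h1 := key _ i j hij
  have h2 := Finset.single_le_sum (f := r) (fun _ _ => Nat.zero_le _) (Finset.mem_univ j)
  omega

/-- Heights of the four basis vectors that are strictly lowered by both members of the canonical
form and by every nilpotent matrix commuting with them. -/
def CanonicalForm.height : CanonicalForm F → Fin 4 → ℕ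
  | .f11 _ _ _ => ![0, 1, 2, 3]
  | .f21 _ _ => ![0, 1, 2, 1]
  | .f22 _ => ![0, 1, 2, 1]
  | .f31 _ _ => ![0, 2, 1, 3]
  | .f32 _ => ![0, 2, 1, 3]
  | .f41 _ => ![0, 3, 1, 2]
  | .f42 => ![0, 1, 1, 2]
  | .f43 => ![0, 3, 2, 1]
  | .f51 => ![0, 1, 2, 3]

theorem CanonicalForm.isCommutingNilpotent_toPair (c : CanonicalForm F) :
    IsCommutingNilpotent c.toPair := by
  refine ⟨isNilpotent_of_height _ c.height ?_, isNilpotent_of_height _ c.height ?_, ?_⟩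
  · intro i j
    cases c <;> fin_cases i <;> fin_cases j <;> simp [toPair, height]
  · intro i j
    cases c <;> fin_cases i <;> fin_cases j <;> simp [toPair, height]
  · ext i j
    cases c <;> fin_cases i <;> fin_cases j <;>
      simp [toPair, Matrix.mul_apply, Fin.sum_univ_four]

set_option maxHeartbeats 2000000 in
/-- The centralizer of each canonical form consists of matrices with a single eigenvalue. -/
theorem CanonicalForm.not_isDecomposable_toPair (c : CanonicalForm F) :
    ¬ IsDecomposable c.toPair := by
  apply not_isDecomposable_of_commute
  intro E hA hB
  refine ⟨E 0 0, isNilpotent_of_height _ c.height ?_⟩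
  have e1 := fun i j => congrFun₂ hA.eq i j
  have e2 := fun i j => congrFun₂ hB.eq i j
  cases c <;>
  simp [toPair, Matrix.mul_apply, Fin.sum_univ_four, Fin.forall_fin_succ] at e1 e2 <;>
  · intro i j
    fin_cases i <;> fin_cases j <;> simp [height] <;> grind

end Indecomposable

/-! ### Uniqueness of the canonical form -/

section Uniqueness

variable {F : Type*} [Field F]

/-- A coarse invariant of the canonical forms, read off from the first members' nilpotency index
and from whether the product of the two members and the square of the second member vanish. -/
def CanonicalForm.kind : CanonicalForm F → ℕ
  | .f11 _ _ _ => 0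
  | .f21 _ _ => 1
  | .f22 _ => 1
  | .f31 _ _ => 2
  | .f32 _ => 3
  | .f43 => 3
  | .f41 _ => 4
  | .f42 => 4
  | .f51 => 5

theorem CanonicalForm.fst_pow_three_eq_zero_iff (c : CanonicalForm F) :
    c.toPair.1 ^ 3 = 0 ↔ 1 ≤ c.kind := by
  rw [← Matrix.ext_iff]
  cases c <;>
    simp [toPair, kind, pow_succ, Matrix.mul_apply, Fin.sum_univ_four, Fin.forall_fin_succ]

theorem CanonicalForm.fst_sq_eq_zero_iff (c : CanonicalForm F) :
    c.toPair.1 ^ 2 = 0 ↔ 2 ≤ c.kind := by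
  rw [← Matrix.ext_iff]
  cases c <;>
    simp [toPair, kind, pow_succ, Matrix.mul_apply, Fin.sum_univ_four, Fin.forall_fin_succ]

theorem CanonicalForm.fst_sq_and_mul_eq_zero_iff (c : CanonicalForm F) :
    c.toPair.1 ^ 2 = 0 ∧ c.toPair.1 * c.toPair.2 = 0 ↔ 3 ≤ c.kind := by
  rw [← Matrix.ext_iff, ← Matrix.ext_iff]
  cases c <;>
    simp [toPair, kind, pow_succ, Matrix.mul_apply, Fin.sum_univ_four, Fin.forall_fin_succ]

theorem CanonicalForm.fst_sq_and_mul_eq_zero_and_snd_sq_ne_zero_iff (c : CanonicalForm F) :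
    (c.toPair.1 ^ 2 = 0 ∧ c.toPair.1 * c.toPair.2 = 0) ∧ ¬ c.toPair.2 ^ 2 = 0 ↔ 4 ≤ c.kind := by
  rw [c.fst_sq_and_mul_eq_zero_iff, ← Matrix.ext_iff]
  cases c <;>
    simp [toPair, kind, pow_succ, Matrix.mul_apply, Fin.sum_univ_four, Fin.forall_fin_succ]

theorem CanonicalForm.fst_eq_zero_iff (c : CanonicalForm F) :
    c.toPair.1 = 0 ↔ 5 ≤ c.kind := by
  rw [← Matrix.ext_iff]
  cases c <;> simp [toPair, kind, Fin.forall_fin_succ]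

theorem CanonicalForm.kind_eq_of_similar {c c' : CanonicalForm F}
    (h : Similar c.toPair c'.toPair) : c.kind = c'.kind := by
  obtain ⟨σ, h1, h2⟩ := h.exists_algEquiv
  have e1 := c'.fst_pow_three_eq_zero_iff
  have e2 := c'.fst_sq_eq_zero_iff
  have e3 := c'.fst_sq_and_mul_eq_zero_iff
  have e4 := c'.fst_sq_and_mul_eq_zero_and_snd_sq_ne_zero_iff
  have e5 := c'.fst_eq_zero_iff
  rw [← h1, ← h2, ← map_pow, ← map_pow, ← map_mul, map_eq_zero_iff σ σ.injective,
    map_eq_zero_iff σ σ.injective, map_eq_zero_iff σ σ.injective,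
    c.fst_sq_and_mul_eq_zero_and_snd_sq_ne_zero_iff] at e4
  rw [← h1, ← h2, ← map_pow, ← map_mul, map_eq_zero_iff σ σ.injective,
    map_eq_zero_iff σ σ.injective, c.fst_sq_and_mul_eq_zero_iff] at e3
  rw [← h1, ← map_pow, map_eq_zero_iff σ σ.injective, c.fst_sq_eq_zero_iff] at e2
  rw [← h1, ← map_pow, map_eq_zero_iff σ σ.injective, c.fst_pow_three_eq_zero_iff] at e1
  rw [← h1, map_eq_zero_iff σ σ.injective, c.fst_eq_zero_iff] at e5
  have b : c.kind ≤ 5 := by cases c <;> simp [kind]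
  have b' : c'.kind ≤ 5 := by cases c' <;> simp [kind]
  omega

theorem eq_of_similar_f11 {l m v l' m' v' : F}
    (h : Similar (CanonicalForm.f11 l m v).toPair (CanonicalForm.f11 l' m' v').toPair) :
    l = l' ∧ m = m' ∧ v = v' := by
  obtain ⟨σ, h1, h2⟩ := h.exists_algEquiv
  have hr : (CanonicalForm.f11 l m v).toPair.2 = l • (CanonicalForm.f11 l m v).toPair.1 +
      m • (CanonicalForm.f11 l m v).toPair.1 ^ 2 + v • (CanonicalForm.f11 l m v).toPair.1 ^ 3 := by
    ext i j
    fin_cases i <;> fin_cases j <;>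
      simp [CanonicalForm.toPair, pow_succ]
  have hr' := congrArg σ hr
  simp only [map_add, map_smul, map_pow, h1, h2] at hr'
  have e := fun j => congrFun₂ hr' 0 j
  simp [CanonicalForm.toPair, pow_succ, Fin.forall_fin_succ] at e
  exact ⟨e.1.symm, e.2.1.symm, e.2.2.symm⟩

theorem relations_of_similar_f21 {l m : F} {Q : MatPair 4 F}
    (h : Similar (CanonicalForm.f21 l m).toPair Q) :
    Q.2 * Q.1 = l • Q.1 ^ 2 ∧ (Q.2 - l • Q.1) ^ 2 = m • Q.1 ^ 2 := by
  obtain ⟨σ, h1, h2⟩ := h.exists_algEquiv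
  rw [← h1, ← h2, ← map_pow, ← map_smul, ← map_smul, ← map_smul, ← map_mul, ← map_sub,
    ← map_pow]
  constructor <;> congr 1 <;> ext i j <;> fin_cases i <;> fin_cases j <;>
    simp [CanonicalForm.toPair, pow_succ, Matrix.mul_apply, Fin.sum_univ_four]

theorem eq_of_similar_f21 {l m l' m' : F}
    (h : Similar (CanonicalForm.f21 l m).toPair (CanonicalForm.f21 l' m').toPair) :
    l = l' ∧ m = m' := by
  obtain ⟨e1, e2⟩ := relations_of_similar_f21 h
  have e1 := congrFun₂ e1 0 2
  have e2 := congrFun₂ e2 0 2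
  simp [CanonicalForm.toPair, pow_succ, Matrix.mul_apply, Fin.sum_univ_four] at e1 e2
  subst e1
  simp at e2
  exact ⟨rfl, e2.symm⟩

theorem eq_of_similar_f22 {l l' : F}
    (h : Similar (CanonicalForm.f22 l).toPair (CanonicalForm.f22 l').toPair) : l = l' := by
  obtain ⟨σ, h1, h2⟩ := h.exists_algEquiv
  have hr : (CanonicalForm.f22 l).toPair.2 * (CanonicalForm.f22 l).toPair.1 =
      l • (CanonicalForm.f22 l).toPair.1 ^ 2 := by
    ext i j
    fin_cases i <;> fin_cases j <;>
      simp [CanonicalForm.toPair, pow_succ, Matrix.mul_apply, Fin.sum_univ_four]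
  have hr' := congrArg σ hr
  simp only [map_mul, map_smul, map_pow, h1, h2] at hr'
  have e := congrFun₂ hr' 0 2
  simp [CanonicalForm.toPair, pow_succ, Matrix.mul_apply, Fin.sum_univ_four] at e
  exact e.symm

/-- The relations leave only `f21 l 0` to be compared with `f22 l`. In the former the kernel of the
first member is contained in the kernel of the second, in the latter it is not. -/
theorem not_similar_f21_f22 {l m l' : F} :
    ¬ Similar (CanonicalForm.f21 l m).toPair (CanonicalForm.f22 l').toPair := by
  intro h
  obtain ⟨e1, e2⟩ := relations_of_similar_f21 h
  have e1 := congrFun₂ e1 0 2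
  have e2 := congrFun₂ e2 0 2
  simp [CanonicalForm.toPair, pow_succ, Matrix.mul_apply, Fin.sum_univ_four] at e1 e2
  subst e1
  simp at e2
  subst e2
  obtain ⟨σ, h1, h2⟩ := h.exists_algEquiv
  have hr : (CanonicalForm.f21 l' 0).toPair.2 - l' • (CanonicalForm.f21 l' 0).toPair.1 =
      Matrix.single 3 1 1 * (CanonicalForm.f21 l' 0).toPair.1 := by
    ext i j
    fin_cases i <;> fin_cases j <;>
      simp [CanonicalForm.toPair, Matrix.mul_apply, Matrix.single]
  have hr' := congrArg σ hr
  simp only [map_mul, map_sub, map_smul, h1, h2] at hr'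
  have e := congrFun₂ hr' 0 3
  simp [CanonicalForm.toPair, Matrix.mul_apply, Fin.sum_univ_four] at e

theorem eq_of_similar_f31 {l m l' m' : F}
    (h : Similar (CanonicalForm.f31 l m).toPair (CanonicalForm.f31 l' m').toPair) :
    l = l' ∧ m = m' := by
  obtain ⟨σ, h1, h2⟩ := h.exists_algEquiv
  have hr : (CanonicalForm.f31 l m).toPair.2 ^ 2 =
      m • ((CanonicalForm.f31 l m).toPair.1 * (CanonicalForm.f31 l m).toPair.2) +
        l • (CanonicalForm.f31 l m).toPair.1 := by
    ext i j
    fin_cases i <;> fin_cases j <;>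
      simp [CanonicalForm.toPair, pow_succ, Matrix.mul_apply, Fin.sum_univ_four]
  have hr' := congrArg σ hr
  simp only [map_add, map_mul, map_smul, map_pow, h1, h2] at hr'
  have e1 := congrFun₂ hr' 0 1
  have e2 := congrFun₂ hr' 0 3
  simp [CanonicalForm.toPair, pow_succ, Matrix.mul_apply, Fin.sum_univ_four] at e1 e2
  exact ⟨e1.symm, e2.symm⟩

theorem eq_of_similar_f32 {l l' : F}
    (h : Similar (CanonicalForm.f32 l).toPair (CanonicalForm.f32 l').toPair) : l = l' := by
  obtain ⟨X, h1, h2⟩ := similar_iff.1 h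
  have e1 := fun i j => congrFun₂ h1 i j
  have e2 := fun i j => congrFun₂ h2 i j
  have e3 := congrFun₂ X.mul_inv 1 1
  simp [CanonicalForm.toPair, Matrix.mul_apply, Fin.sum_univ_four, Fin.forall_fin_succ] at e1 e2 e3
  -- Otherwise the second row of the transition matrix vanishes.
  by_contra hne
  have h10 : X.val 1 0 = 0 := by grind
  have h11 : X.val 1 1 = 0 := by grind
  have h12 : X.val 1 2 = 0 := by grind
  have h13 : X.val 1 3 = 0 := by grind
  simp [h10, h11, h12, h13] at e3

/-- The first members have different ranks: the second and fourth rows of a transition matrix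
would both be supported on the second column. -/
theorem not_similar_f32_f43 {l : F} :
    ¬ Similar (CanonicalForm.f32 l).toPair (CanonicalForm.f43 : CanonicalForm F).toPair := by
  intro h
  obtain ⟨X, h1, -⟩ := similar_iff.1 h
  have e1 := fun i j => congrFun₂ h1 i j
  have e2 := congrFun₂ X.mul_inv 1 1
  have e3 := congrFun₂ X.mul_inv 1 3
  have e4 := congrFun₂ X.mul_inv 3 3
  simp [CanonicalForm.toPair, Matrix.mul_apply, Fin.sum_univ_four, Fin.forall_fin_succ]
    at e1 e2 e3 e4
  grind

theorem cube_snd_of_similar_f41 {l : F} {Q : MatPair 4 F}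
    (h : Similar (CanonicalForm.f41 l).toPair Q) : Q.2 ^ 3 = l • Q.1 := by
  obtain ⟨σ, h1, h2⟩ := h.exists_algEquiv
  rw [← h1, ← h2, ← map_pow, ← map_smul]
  congr 1
  ext i j
  fin_cases i <;> fin_cases j <;>
    simp [CanonicalForm.toPair, pow_succ, Matrix.mul_apply, Fin.sum_univ_four]

theorem eq_of_similar_f41 {l l' : F}
    (h : Similar (CanonicalForm.f41 l).toPair (CanonicalForm.f41 l').toPair) : l = l' := by
  have e := congrFun₂ (cube_snd_of_similar_f41 h) 0 1
  simp [CanonicalForm.toPair, pow_succ, Matrix.mul_apply, Fin.sum_univ_four] at e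
  exact e.symm

/-- The cube of the second member leaves only `f41 0` to be compared with `f42`. In the latter the
image of the first member is contained in that of the square of the second member, in the former
it is not. -/
theorem not_similar_f41_f42 {l : F} :
    ¬ Similar (CanonicalForm.f41 l).toPair (CanonicalForm.f42 : CanonicalForm F).toPair := by
  intro h
  have e := congrFun₂ (cube_snd_of_similar_f41 h) 0 1
  simp [CanonicalForm.toPair, pow_succ, Matrix.mul_apply, Fin.sum_univ_four] at e
  subst e
  obtain ⟨σ, h1, h2⟩ := h.symm.exists_algEquiv
  have hr : (CanonicalForm.f42 : CanonicalForm F).toPair.1 =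
      (CanonicalForm.f42 : CanonicalForm F).toPair.2 ^ 2 * Matrix.single 3 1 1 := by
    ext i j
    fin_cases i <;> fin_cases j <;>
      simp [CanonicalForm.toPair, pow_succ, Matrix.mul_apply, Matrix.single]
  have hr' := congrArg σ hr
  simp only [map_mul, map_pow, h1, h2] at hr'
  have e := congrFun₂ hr' 0 1
  simp [CanonicalForm.toPair, pow_succ, Matrix.mul_apply] at e

theorem CanonicalForm.eq_of_similar {c c' : CanonicalForm F}
    (h : Similar c.toPair c'.toPair) : c = c' := by
  have hk := kind_eq_of_similar h
  cases c <;> cases c' <;> simp only [kind] at hk <;> try omega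
  · obtain ⟨rfl, rfl, rfl⟩ := eq_of_similar_f11 h; rfl
  · obtain ⟨rfl, rfl⟩ := eq_of_similar_f21 h; rfl
  · exact absurd h not_similar_f21_f22
  · exact absurd h.symm not_similar_f21_f22
  · rw [eq_of_similar_f22 h]
  · obtain ⟨rfl, rfl⟩ := eq_of_similar_f31 h; rfl
  · rw [eq_of_similar_f32 h]
  · exact absurd h not_similar_f32_f43
  · rw [eq_of_similar_f41 h]
  · exact absurd h not_similar_f41_f42
  · exact absurd h.symm not_similar_f41_f42
  · rfl
  · exact absurd h.symm not_similar_f32_f43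
  · rfl
  · rfl

end Uniqueness

end CommNilp

theorem mainTheorem1 {F : Type*} [Field F] [IsAlgClosed F] :
    (∀ P : CommNilp.MatPair 4 F,
      CommNilp.IsCommutingNilpotent P → ¬ CommNilp.IsDecomposable P →
        ∃! c : CommNilp.CanonicalForm F, CommNilp.Similar P c.toPair) ∧
    (∀ c : CommNilp.CanonicalForm F,
      CommNilp.IsCommutingNilpotent c.toPair ∧ ¬ CommNilp.IsDecomposable c.toPair) := by
  refine ⟨fun P hP hind => ?_, fun c => ⟨c.isCommutingNilpotent_toPair,
    c.not_isDecomposable_toPair⟩⟩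
  obtain ⟨c, hc⟩ := (CommNilp.isDecomposable_or_exists_form hP).resolve_left hind
  exact ⟨c, hc, fun c' hc' => CommNilp.CanonicalForm.eq_of_similar (hc'.symm.trans hc)⟩
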